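/- Let $X$, $Y$ (non-empty) and $Z$ be finite sets of producer types, consumer types and qualities. There is a mass $n_x>0$ of producers of each type $x$ and a mass $m_y>0$ of consumers of each type $y$; let $\alpha_{xz},\gamma_{zy}\in\mathbb{R}$. Let $\mathbf P_x$ and $\mathbf Q_y$ be probability distributions on $\mathbb{R}^{Z\cup\{0\}}$ with full support (every non-empty open set has positive probability) and finite first moments. At prices $p\in\mathbb{R}^Z$, a producer of type $x$ with shock $\varepsilon\sim\mathbf P_x$ gets $\alpha_{xz}+p_z+\varepsilon_z$ from producing quality $z$ and $\varepsilon_0$ from staying out of the market; a consumer of type $y$ with shock $\eta\sim\mathbf Q_y$ gets $\gamma_{zy}-p_z+\eta_z$ from consuming quality $z$ and $\eta_0$ from staying out. Put $$G_x(U)=\mathbb{E}_{\mathbf P_x}\Big[\max\big(\varepsilon_0,\max_{z\in Z}(U_z+\varepsilon_z)\big)\Big],\qquad H_y(V)=\mathbb{E}_{\mathbf Q_y}\Big[\max\big(\eta_0,\max_{z\in Z}(V_z+\eta_z)\big)\Big],$$ $$G_x^*(q)=\sup_{U\in\mathbb{R}^Z}\Big(\sum_z q_zU_z-G_x(U)\Big)\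 \text{ if } \sum_z q_z\le 1,\qquad G_x^*(q)=+\infty\ \text{ otherwise},$$ and define $H_y^*$ likewise. A pair $\mu=((\mu_{xz}),(\mu_{zy}))$ of a supply and a demand is feasible if $\mu\ge 0$, $\sum_z\mu_{xz}\le n_x$, $\sum_z\mu_{zy}\le m_y$ and $\sum_x\mu_{xz}=\sum_y\mu_{zy}$ for all $x,y,z$. Its generalized entropy is $$\mathcal{E}(\mu)=\sum_x n_xG_x^*\big((\mu_{xz}/n_x)_z\big)+\sum_y m_yH_y^*\big((\mu_{zy}/m_y)_z\big).$$ An allocation prescribes, measurably, which fractions of the agents of each observable type with each shock take each quality or stay out, such that supply equals demand for every quality. Its social welfare is the total surplus of all agents, payments (which cancel) left out. An equilibrium is a triple $(p,(\mu_{xz}),(\mu_{zy}))$ such that $\mu$ is feasible and $\mu_{xz}$ (resp. $\mu_{zy}$) is the mass of agents of type $x$ (resp. $y$) that choose $z$ when almost every agent only takes options that are optimal for her at prices $p$. (i) The maximal social welfare $\mathcal{W}$ over all allocations exists, and $$\mathcal{W}=\min_{p\in\mathbb{R}^Z}\ \sum_{x}n_xG_x(\alpha_{x\cdot}+p)+\sum_{y}m_yH_y(\gamma_{\cdot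 y}-p).$$ (ii) Also, $$\mathcal{W}=\max_{\mu\ \text{feasible}}\ \sum_{x,z}\mu_{xz}\alpha_{xz}+\sum_{y,z}\mu_{zy}\gamma_{zy}-\mathcal{E}(\mu).$$ Both the minimum and the maximum are attained. (iii) An equilibrium exists. In every equilibrium, $p$ is a minimizer in (i), which is unique, and $\mu$ is a maximizer in (ii). If, moreover, any two distinct options are tied with probability zero, that is, $\mathbf P_x(\varepsilon_o-\varepsilon_{o'}=c)=0$ and $\mathbf Q_y(\eta_o-\eta_{o'}=c)=0$ for all $x$, $y$, all $o\ne o'$ in $Z\cup\{0\}$ and all $c\in\mathbb{R}$ (for example if these distributions have densities), then the equilibrium $(p,(\mu_{xz}),(\mu_{zy}))$ is unique, and so is the maximizer in (ii). -/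

import Mathlib

open MeasureTheory

namespace Hedonic

noncomputable section

/-! One side of the market. `Z` is the set of qualities; `Option Z` is the set of options of an
agent, `none` being the outside option of not participating. A shock is a vector
`ε : Option Z → ℝ`. -/

/-- Payoff of option `o` for an agent with systematic utilities `U` (the outside option has
systematic utility `0`) and shock `ε`. -/
def payoff {Z : Type*} (U : Z → ℝ) (ε : Option Z → ℝ) (o : Option Z) : ℝ :=
  o.elim 0 U + ε o

/-- Expected indirect utility `G(U) = 𝔼[max_z (U_z + ε_z, ε_0)]` when shocks have law `P`. -/
def indirectUtility {Z : Type*} [Fintype Z] (P : Measure (Option Z → ℝ)) (U : Z → ℝ) : ℝ :=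
  ∫ ε, Finset.univ.sup' Finset.univ_nonempty (payoff U ε) ∂P

/-- Convex conjugate `G*` of the expected indirect utility, with values in the extended reals. -/
def conjugate {Z : Type*} [Fintype Z] (P : Measure (Option Z → ℝ)) (q : Z → ℝ) : EReal :=
  if ∑ z, q z ≤ 1 then
    ⨆ U : Z → ℝ, ((∑ z, q z * U z - indirectUtility P U : ℝ) : EReal)
  else ⊤

/-- Two distinct options are tied with probability zero, whatever their systematic utilities. -/
def NoTies {Z : Type*} (P : Measure (Option Z → ℝ)) : Prop :=
  ∀ o o' : Option Z, o ≠ o' → ∀ c : ℝ, P {ε | ε o - ε o' = c} = 0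

/-- A choice rule: `σ ε o` is the fraction of the agents with shock `ε` that take option `o`. -/
structure IsChoiceRule {Z : Type*} [Fintype Z]
    (σ : (Option Z → ℝ) → Option Z → ℝ) : Prop where
  measurable : Measurable σ
  nonneg : ∀ ε o, 0 ≤ σ ε o
  sum_eq_one : ∀ ε, ∑ o, σ ε o = 1

/-- Rationality: almost every agent avoids every option that is strictly worse for her than
another one. -/
def IsRational {Z : Type*} (P : Measure (Option Z → ℝ)) (U : Z → ℝ)
    (σ : (Option Z → ℝ) → Option Z → ℝ) : Prop :=
  ∀ᵐ ε ∂P, ∀ o o' : Option Z, payoff U ε o < payoff U ε o' → σ ε o = 0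

/-- Fraction of the agents that choose quality `z` under the choice rule `σ`. -/
def share {Z : Type*} (P : Measure (Option Z → ℝ)) (σ : (Option Z → ℝ) → Option Z → ℝ)
    (z : Z) : ℝ :=
  ∫ ε, σ ε (some z) ∂P

/-- Average payoff of the agents under the choice rule `σ`. -/
def meanPayoff {Z : Type*} [Fintype Z] (P : Measure (Option Z → ℝ)) (U : Z → ℝ)
    (σ : (Option Z → ℝ) → Option Z → ℝ) : ℝ :=
  ∫ ε, ∑ o, σ ε o * payoff U ε o ∂P

/-- The primitives of the economy: masses `n x` of producers and `m y` of consumers of each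
observable type, systematic productivities `α x z` and utilities `γ z y`, and the laws `P x` and
`Q y` of the shocks of the producers and of the consumers of each observable type. -/
structure Economy (X Y Z : Type*) where
  n : X → ℝ
  m : Y → ℝ
  α : X → Z → ℝ
  γ : Z → Y → ℝ
  P : X → Measure (Option Z → ℝ)
  Q : Y → Measure (Option Z → ℝ)

namespace Economy

variable {X Y Z : Type*} [Fintype X] [Fintype Y] [Fintype Z] (E : Economy X Y Z)

/-- Sum of the producers' and the consumers' expected indirect surpluses at prices `p`:
`∑ n_x G_x(α_x· + p) + ∑ m_y H_y(γ_·y - p)`. -/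
def totalSurplus (p : Z → ℝ) : ℝ :=
  ∑ x, E.n x * indirectUtility (E.P x) (fun z => E.α x z + p z)
    + ∑ y, E.m y * indirectUtility (E.Q y) (fun z => E.γ z y - p z)

/-- An allocation of the individual agents to the options, for which all agents follow some
choice rule and the market of every quality clears. -/
structure IsAllocation (σ : X → (Option Z → ℝ) → Option Z → ℝ)
    (τ : Y → (Option Z → ℝ) → Option Z → ℝ) : Prop where
  producers : ∀ x, IsChoiceRule (σ x)
  consumers : ∀ y, IsChoiceRule (τ y)
  clearing : ∀ z, ∑ x, E.n x * share (E.P x) (σ x) z = ∑ y, E.m y * share (E.Q y) (τ y) z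

/-- Social welfare of an allocation: the total (pre-transfer) surplus of all agents. Payments
cancel out when markets clear. -/
def welfare (σ : X → (Option Z → ℝ) → Option Z → ℝ)
    (τ : Y → (Option Z → ℝ) → Option Z → ℝ) : ℝ :=
  ∑ x, E.n x * meanPayoff (E.P x) (E.α x) (σ x)
    + ∑ y, E.m y * meanPayoff (E.Q y) (fun z => E.γ z y) (τ y)

/-- Nonnegative supply `μ x z` and demand `ν z y` that satisfy people counting and market
clearing. -/
structure IsFeasible (μ : X → Z → ℝ) (ν : Z → Y → ℝ) : Prop where
  supply_nonneg : ∀ x z, 0 ≤ μ x z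
  demand_nonneg : ∀ z y, 0 ≤ ν z y
  producers_le : ∀ x, ∑ z, μ x z ≤ E.n x
  consumers_le : ∀ y, ∑ z, ν z y ≤ E.m y
  clearing : ∀ z, ∑ x, μ x z = ∑ y, ν z y

/-- Generalized entropy `∑ n_x G_x*(μ_{·|x}) + ∑ m_y H_y*(ν_{·|y})`, where
`μ_{z|x} = μ_xz / n_x` and `ν_{z|y} = ν_zy / m_y`. -/
def entropy (μ : X → Z → ℝ) (ν : Z → Y → ℝ) : EReal :=
  ∑ x, (E.n x : EReal) * conjugate (E.P x) (fun z => μ x z / E.n x)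
    + ∑ y, (E.m y : EReal) * conjugate (E.Q y) (fun z => ν z y / E.m y)

/-- The quantity `∑ μ_xz α_xz + ∑ ν_zy γ_zy - 𝓔(μ, ν)`. -/
def quantityObjective (μ : X → Z → ℝ) (ν : Z → Y → ℝ) : EReal :=
  ((∑ x, ∑ z, μ x z * E.α x z + ∑ y, ∑ z, ν z y * E.γ z y : ℝ) : EReal) - E.entropy μ ν

/-- `(p, μ, ν)` is an equilibrium: supply and demand satisfy people counting and market clearing,
and result from individual choices that are rational at prices `p`. -/
structure IsEquilibrium (p : Z → ℝ) (μ : X → Z → ℝ) (ν : Z → Y → ℝ) : Prop where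
  feasible : E.IsFeasible μ ν
  producers : ∀ x, ∃ σ, IsChoiceRule σ ∧ IsRational (E.P x) (fun z => E.α x z + p z) σ ∧
    ∀ z, μ x z = E.n x * share (E.P x) σ z
  consumers : ∀ y, ∃ τ, IsChoiceRule τ ∧ IsRational (E.Q y) (fun z => E.γ z y - p z) τ ∧
    ∀ z, ν z y = E.m y * share (E.Q y) τ z

end Economy

end

end Hedonic

/-!
Everything follows from convex duality, with the prices as multipliers of the market-clearing
constraints. Payments cancel, so at any prices `p` the welfare of an allocation is the sum of the
agents' mean payoffs at `p`, hence at most `totalSurplus p`, with equality when all agents are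
rational at `p` (`IsAllocation.welfare_le`, `IsAllocation.welfare_eq_totalSurplus`). Likewise,
`totalSurplus p - quantityObjective μ ν` is a weighted sum of the nonnegative gaps in the Fenchel
inequalities of the different types (`IsFeasible.exists_quantityObjective_eq`), and these gaps
vanish when `μ` and `ν` come from rational choices at `p`. So all claims on optimal values reduce
to the existence of a minimizer `p` of the total surplus and of an equilibrium at `p`.

The total surplus is continuous and coercive, as there are both producers and consumers, so it has
a minimizer. Under full support it is strictly convex: for different systematic utilities, an open
set of shocks leads to different strict optima. So the minimizer is unique.

The equilibrium at the minimizer comes from tie-breaking. The shares generated by rational agents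
who break ties in a way that depends only on their set of optimal options form a compact convex
set `tieShares P U`, as there are finitely many such sets. By dominated convergence, the derivative
of the expected indirect utility at `U` along `d` is the scalar product of `d` with one of these
vectors of shares (`exists_tieShares_tendsto`). If no tie-breaking made all markets clear, the set
of excess supplies could be separated from zero, and the total surplus would decrease in the
direction of the normal of the hyperplane (`exists_tieShares_clearing`).

If there are no ties, the same derivative shows that the expected indirect utility has only one
subgradient, the vector of shares of any rational choice rule
(`NoTies.eq_share_of_subgradient`). Quantities without duality gap are such subgradients, so they
are unique.
-/

namespace Hedonic

open Filter Topology

/-! ### Choice rules and the expected indirect utility -/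

/-- Indirect utility `max_o payoff U ε o` of an agent with shock `ε`. -/
noncomputable def maxPayoff {Z : Type*} [Fintype Z] (U : Z → ℝ) (ε : Option Z → ℝ) : ℝ :=
  Finset.univ.sup' Finset.univ_nonempty (payoff U ε)

section OneSide

variable {Z : Type*} [Fintype Z]

omit [Fintype Z] in
theorem payoff_add (U V : Z → ℝ) (ε : Option Z → ℝ) (o : Option Z) :
    payoff (fun z => U z + V z) ε o = payoff U ε o + o.elim 0 V := by
  cases o <;> simp [payoff]; ring

theorem payoff_le_maxPayoff (U : Z → ℝ) (ε : Option Z → ℝ) (o : Option Z) :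
    payoff U ε o ≤ maxPayoff U ε :=
  Finset.le_sup' (payoff U ε) (Finset.mem_univ o)

theorem maxPayoff_le {U : Z → ℝ} {ε : Option Z → ℝ} {c : ℝ} (h : ∀ o, payoff U ε o ≤ c) :
    maxPayoff U ε ≤ c :=
  Finset.sup'_le _ _ fun o _ => h o

theorem exists_payoff_eq_maxPayoff (U : Z → ℝ) (ε : Option Z → ℝ) :
    ∃ o, payoff U ε o = maxPayoff U ε := by
  obtain ⟨o, -, h⟩ := Finset.exists_mem_eq_sup' Finset.univ_nonempty (payoff U ε)
  exact ⟨o, h.symm⟩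

omit [Fintype Z] in
theorem continuous_payoff (U : Z → ℝ) (o : Option Z) : Continuous fun ε => payoff U ε o := by
  unfold payoff
  fun_prop

theorem continuous_maxPayoff (U : Z → ℝ) : Continuous (maxPayoff U) :=
  Continuous.finset_sup'_apply Finset.univ_nonempty fun o _ => continuous_payoff U o

theorem maxPayoff_le_add_dist (U V : Z → ℝ) (ε : Option Z → ℝ) :
    maxPayoff U ε ≤ maxPayoff V ε + dist U V := by
  refine maxPayoff_le fun o => ?_
  have h1 := payoff_le_maxPayoff V ε o
  have h2 : payoff U ε o ≤ payoff V ε o + dist U V := by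
    cases o with
    | none => simp [payoff]
    | some z =>
      have h3 := dist_le_pi_dist U V z
      rw [Real.dist_eq] at h3
      have h4 := le_abs_self (U z - V z)
      simp only [payoff, Option.elim_some]
      linarith
  linarith

theorem IsChoiceRule.le_one {σ : (Option Z → ℝ) → Option Z → ℝ} (hσ : IsChoiceRule σ)
    (ε : Option Z → ℝ) (o : Option Z) : σ ε o ≤ 1 := by
  rw [← hσ.sum_eq_one ε]
  exact Finset.single_le_sum (fun o _ => hσ.nonneg ε o) (Finset.mem_univ o)

theorem IsChoiceRule.const {v : Option Z → ℝ} (h0 : ∀ o, 0 ≤ v o) (h1 : ∑ o, v o = 1) :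
    IsChoiceRule fun _ : Option Z → ℝ => v :=
  ⟨measurable_const, fun _ => h0, fun _ => h1⟩

theorem IsChoiceRule.sum_mul_payoff_le {σ : (Option Z → ℝ) → Option Z → ℝ}
    (hσ : IsChoiceRule σ) (U : Z → ℝ) (ε : Option Z → ℝ) :
    ∑ o, σ ε o * payoff U ε o ≤ maxPayoff U ε := by
  calc ∑ o, σ ε o * payoff U ε o ≤ ∑ o, σ ε o * maxPayoff U ε :=
        Finset.sum_le_sum fun o _ =>
          mul_le_mul_of_nonneg_left (payoff_le_maxPayoff U ε o) (hσ.nonneg ε o)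
    _ = maxPayoff U ε := by rw [← Finset.sum_mul, hσ.sum_eq_one, one_mul]

variable {P : Measure (Option Z → ℝ)} [IsProbabilityMeasure P]

theorem IsChoiceRule.integrable {σ : (Option Z → ℝ) → Option Z → ℝ} (hσ : IsChoiceRule σ)
    (o : Option Z) : Integrable (fun ε => σ ε o) P := by
  refine Integrable.of_bound (C := 1)
    ((measurable_pi_apply o).comp hσ.measurable).aestronglyMeasurable (ae_of_all _ fun ε => ?_)
  rw [Real.norm_eq_abs, abs_of_nonneg (hσ.nonneg ε o)]
  exact hσ.le_one ε o

omit [IsProbabilityMeasure P] in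
theorem IsChoiceRule.share_nonneg {σ : (Option Z → ℝ) → Option Z → ℝ} (hσ : IsChoiceRule σ)
    (z : Z) : 0 ≤ share P σ z :=
  integral_nonneg fun ε => hσ.nonneg ε (some z)

theorem IsChoiceRule.sum_share_le_one {σ : (Option Z → ℝ) → Option Z → ℝ}
    (hσ : IsChoiceRule σ) : ∑ z, share P σ z ≤ 1 := by
  unfold share
  rw [← integral_finsetSum _ fun z _ => hσ.integrable (some z)]
  calc ∫ ε, ∑ z, σ ε (some z) ∂P ≤ ∫ _, (1 : ℝ) ∂P := by
        refine integral_mono (integrable_finsetSum _ fun z _ => hσ.integrable (some z))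
          (integrable_const _) fun ε => ?_
        have h1 := hσ.sum_eq_one ε
        have h2 := hσ.nonneg ε none
        rw [Fintype.sum_option] at h1
        simp only
        linarith
    _ = 1 := by simp

omit [Fintype Z] in
theorem integrable_payoff (hP : ∀ o, Integrable (fun ε : Option Z → ℝ => ε o) P) (U : Z → ℝ)
    (o : Option Z) : Integrable (fun ε => payoff U ε o) P :=
  (integrable_const _).add (hP o)

theorem integrable_maxPayoff (hP : ∀ o, Integrable (fun ε : Option Z → ℝ => ε o) P)
    (U : Z → ℝ) : Integrable (maxPayoff U) P := by
  refine Integrable.mono' (integrable_finsetSum Finset.univ fun o _ =>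
    (integrable_payoff hP U o).abs) (continuous_maxPayoff U).aestronglyMeasurable
    (ae_of_all _ fun ε => ?_)
  obtain ⟨o, ho⟩ := exists_payoff_eq_maxPayoff U ε
  rw [← ho, Real.norm_eq_abs]
  exact Finset.single_le_sum (f := fun o => |payoff U ε o|) (fun _ _ => abs_nonneg _)
    (Finset.mem_univ o)

omit [IsProbabilityMeasure P] in
theorem integral_maxPayoff (U : Z → ℝ) : ∫ ε, maxPayoff U ε ∂P = indirectUtility P U := rfl

theorem IsChoiceRule.integrable_sum_mul_payoff {σ : (Option Z → ℝ) → Option Z → ℝ}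
    (hσ : IsChoiceRule σ) (hP : ∀ o, Integrable (fun ε : Option Z → ℝ => ε o) P) (U : Z → ℝ) :
    Integrable (fun ε => ∑ o, σ ε o * payoff U ε o) P := by
  refine integrable_finsetSum _ fun o _ => ?_
  refine (integrable_payoff hP U o).bdd_mul (c := 1)
    ((measurable_pi_apply o).comp hσ.measurable).aestronglyMeasurable (ae_of_all _ fun ε => ?_)
  rw [Real.norm_eq_abs, abs_of_nonneg (hσ.nonneg ε o)]
  exact hσ.le_one ε o

/-- Shifting the systematic utilities by `V` raises the mean payoff of a fixed choice rule
by the scalar product of `V` with the shares. -/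
theorem IsChoiceRule.meanPayoff_add {σ : (Option Z → ℝ) → Option Z → ℝ}
    (hσ : IsChoiceRule σ) (hP : ∀ o, Integrable (fun ε : Option Z → ℝ => ε o) P)
    (U V : Z → ℝ) :
    meanPayoff P (fun z => U z + V z) σ = meanPayoff P U σ + ∑ z, V z * share P σ z := by
  have h : ∀ ε, ∑ o, σ ε o * payoff (fun z => U z + V z) ε o
      = ∑ o, σ ε o * payoff U ε o + ∑ z, V z * σ ε (some z) := by
    intro ε
    simp only [payoff_add, mul_add, Finset.sum_add_distrib]
    congr 1
    rw [Fintype.sum_option]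
    simp [mul_comm]
  have hi : ∀ z, Integrable (fun ε => V z * σ ε (some z)) P := fun z =>
    (hσ.integrable (some z)).const_mul _
  simp only [meanPayoff, h, share]
  rw [integral_add (hσ.integrable_sum_mul_payoff hP U) (integrable_finsetSum _ fun z _ => hi z),
    integral_finsetSum _ fun z _ => hi z]
  simp only [integral_const_mul]

theorem IsChoiceRule.meanPayoff_le {σ : (Option Z → ℝ) → Option Z → ℝ}
    (hσ : IsChoiceRule σ) (hP : ∀ o, Integrable (fun ε : Option Z → ℝ => ε o) P) (U : Z → ℝ) :
    meanPayoff P U σ ≤ indirectUtility P U :=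
  integral_mono (hσ.integrable_sum_mul_payoff hP U) (integrable_maxPayoff hP U)
    fun ε => hσ.sum_mul_payoff_le U ε

omit [IsProbabilityMeasure P] in
theorem IsRational.meanPayoff_eq {σ : (Option Z → ℝ) → Option Z → ℝ} {U : Z → ℝ}
    (h : IsRational P U σ) (hσ : IsChoiceRule σ) :
    meanPayoff P U σ = indirectUtility P U := by
  refine integral_congr_ae ?_
  filter_upwards [h] with ε hε
  change _ = maxPayoff U ε
  rw [← one_mul (maxPayoff U ε), ← hσ.sum_eq_one ε, Finset.sum_mul]
  refine Finset.sum_congr rfl fun o _ => ?_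
  obtain ⟨o', ho'⟩ := exists_payoff_eq_maxPayoff U ε
  rcases (payoff_le_maxPayoff U ε o).lt_or_eq with hlt | heq
  · rw [hε o o' (ho' ▸ hlt), zero_mul, zero_mul]
  · rw [heq]

theorem continuous_indirectUtility (hP : ∀ o, Integrable (fun ε : Option Z → ℝ => ε o) P) :
    Continuous (indirectUtility P) := by
  refine (LipschitzWith.of_le_add fun U V => ?_).continuous
  calc indirectUtility P U ≤ ∫ ε, (maxPayoff V ε + dist U V) ∂P :=
        integral_mono (integrable_maxPayoff hP U)
          ((integrable_maxPayoff hP V).add (integrable_const _))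
          fun ε => maxPayoff_le_add_dist U V ε
    _ = indirectUtility P V + dist U V := by
        rw [integral_add (integrable_maxPayoff hP V) (integrable_const _), integral_maxPayoff]
        simp

theorem le_indirectUtility (hP : ∀ o, Integrable (fun ε : Option Z → ℝ => ε o) P) (U : Z → ℝ)
    (o : Option Z) : o.elim 0 U + ∫ ε, ε o ∂P ≤ indirectUtility P U := by
  calc o.elim 0 U + ∫ ε, ε o ∂P = ∫ ε, payoff U ε o ∂P := by
        unfold payoff
        rw [integral_add (integrable_const _) (hP o)]
        simp
    _ ≤ indirectUtility P U := integral_mono (integrable_payoff hP U o)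
        (integrable_maxPayoff hP U) fun ε => payoff_le_maxPayoff U ε o

/-! ### Convexity, strict under full support -/

theorem maxPayoff_midpoint_le (U V : Z → ℝ) (ε : Option Z → ℝ) :
    maxPayoff (fun z => (U z + V z) / 2) ε ≤ (maxPayoff U ε + maxPayoff V ε) / 2 := by
  refine maxPayoff_le fun o => ?_
  have h1 := payoff_le_maxPayoff U ε o
  have h2 := payoff_le_maxPayoff V ε o
  have h3 : payoff (fun z => (U z + V z) / 2) ε o = (payoff U ε o + payoff V ε o) / 2 := by
    cases o <;> simp [payoff]; ring
  linarith

theorem integrable_maxPayoff_gap (hP : ∀ o, Integrable (fun ε : Option Z → ℝ => ε o) P)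
    (U V : Z → ℝ) : Integrable (fun ε => (maxPayoff U ε + maxPayoff V ε) / 2
      - maxPayoff (fun z => (U z + V z) / 2) ε) P :=
  (((integrable_maxPayoff hP U).add (integrable_maxPayoff hP V)).div_const 2).sub
    (integrable_maxPayoff hP _)

theorem integral_maxPayoff_gap (hP : ∀ o, Integrable (fun ε : Option Z → ℝ => ε o) P)
    (U V : Z → ℝ) : ∫ ε, ((maxPayoff U ε + maxPayoff V ε) / 2
      - maxPayoff (fun z => (U z + V z) / 2) ε) ∂P
      = (indirectUtility P U + indirectUtility P V) / 2
        - indirectUtility P (fun z => (U z + V z) / 2) := by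
  have hU := integrable_maxPayoff hP U
  have hV := integrable_maxPayoff hP V
  have hUV : Integrable (fun ε => (maxPayoff U ε + maxPayoff V ε) / 2) P :=
    (hU.add hV).div_const 2
  rw [integral_sub hUV (integrable_maxPayoff hP _), integral_div, integral_add hU hV]
  rfl

theorem indirectUtility_midpoint_le (hP : ∀ o, Integrable (fun ε : Option Z → ℝ => ε o) P)
    (U V : Z → ℝ) : indirectUtility P (fun z => (U z + V z) / 2)
      ≤ (indirectUtility P U + indirectUtility P V) / 2 := by
  rw [← sub_nonneg, ← integral_maxPayoff_gap hP]
  exact integral_nonneg fun ε => sub_nonneg.2 (maxPayoff_midpoint_le U V ε)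

/-- If `V z < U z`, some shock makes `z` strictly better than staying out at `U`, staying out
strictly better than `z` at `V`, and every other quality bad at both. -/
theorem exists_maxPayoff_midpoint_lt {U V : Z → ℝ} {z : Z} (h : V z < U z) :
    ∃ ε, maxPayoff (fun z => (U z + V z) / 2) ε < (maxPayoff U ε + maxPayoff V ε) / 2 := by
  classical
  let ε : Option Z → ℝ := fun o =>
    o.elim 0 fun w => if w = z then -(U w + V w) / 2 else -(|U w| + |V w|)
  refine ⟨ε, ?_⟩
  have h1 : (U z - V z) / 2 ≤ maxPayoff U ε := by
    refine le_trans (le_of_eq ?_) (payoff_le_maxPayoff U ε (some z))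
    simp only [payoff, ε, Option.elim_some, if_true]
    ring
  have h2 : 0 ≤ maxPayoff V ε := by
    refine le_trans (le_of_eq ?_) (payoff_le_maxPayoff V ε none)
    simp [payoff, ε]
  have h3 : maxPayoff (fun z => (U z + V z) / 2) ε ≤ 0 := by
    refine maxPayoff_le fun o => ?_
    cases o with
    | none => simp [payoff, ε]
    | some w =>
      simp only [payoff, ε, Option.elim_some]
      split_ifs with hw
      · linarith
      · linarith [le_abs_self (U w), le_abs_self (V w), abs_nonneg (U w), abs_nonneg (V w)]
  linarith

theorem indirectUtility_midpoint_lt [P.IsOpenPosMeasure]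
    (hP : ∀ o, Integrable (fun ε : Option Z → ℝ => ε o) P) {U V : Z → ℝ} (h : U ≠ V) :
    indirectUtility P (fun z => (U z + V z) / 2)
      < (indirectUtility P U + indirectUtility P V) / 2 := by
  obtain ⟨ε, hε⟩ :
      ∃ ε, maxPayoff (fun z => (U z + V z) / 2) ε < (maxPayoff U ε + maxPayoff V ε) / 2 := by
    obtain ⟨z, hz⟩ := Function.ne_iff.1 h
    rcases hz.lt_or_gt with hz | hz
    · obtain ⟨ε, hε⟩ := exists_maxPayoff_midpoint_lt hz
      refine ⟨ε, ?_⟩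
      rw [add_comm (maxPayoff U ε)]
      simpa only [add_comm] using hε
    · exact exists_maxPayoff_midpoint_lt hz
  rw [← sub_pos, ← integral_maxPayoff_gap hP, integral_pos_iff_support_of_nonneg
    (fun ε => sub_nonneg.2 (maxPayoff_midpoint_le U V ε)) (integrable_maxPayoff_gap hP U V)]
  refine IsOpen.measure_pos P ?_ ⟨ε, (sub_pos.2 hε).ne'⟩
  refine Continuous.isOpen_support ?_
  exact (((continuous_maxPayoff U).add (continuous_maxPayoff V)).div_const 2).sub
    (continuous_maxPayoff _)

/-! ### Tie-breaking and directional derivatives -/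

open Classical in
/-- The set of optimal options of an agent with shock `ε`. -/
noncomputable def optimal (U : Z → ℝ) (ε : Option Z → ℝ) : Finset (Option Z) :=
  {o | ∀ o', payoff U ε o' ≤ payoff U ε o}

/-- The choice rule of agents who break ties according to `w`: those whose set of optimal options
is `A` take option `o` in proportion `w A o`. -/
noncomputable def tieRule (U : Z → ℝ) (w : Finset (Option Z) → Option Z → ℝ)
    (ε : Option Z → ℝ) : Option Z → ℝ :=
  w (optimal U ε)

/-- The tie-breaking schemes: probability vectors `w A`, carried by `A` unless `A` is empty (which
never is a set of optimal options). -/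
def tieWeights (Z : Type*) [Fintype Z] : Set (Finset (Option Z) → Option Z → ℝ) :=
  Set.univ.pi fun A => {v ∈ stdSimplex ℝ (Option Z) | A.Nonempty → ∀ o ∉ A, v o = 0}

/-- The vectors of shares that rational agents can generate by breaking ties. -/
def tieShares (P : Measure (Option Z → ℝ)) (U : Z → ℝ) : Set (Z → ℝ) :=
  (fun w z => share P (tieRule U w) z) '' tieWeights Z

theorem mem_optimal {U : Z → ℝ} {ε : Option Z → ℝ} {o : Option Z} :
    o ∈ optimal U ε ↔ ∀ o', payoff U ε o' ≤ payoff U ε o := by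
  simp [optimal]

theorem optimal_nonempty (U : Z → ℝ) (ε : Option Z → ℝ) : (optimal U ε).Nonempty := by
  obtain ⟨o, ho⟩ := exists_payoff_eq_maxPayoff U ε
  exact ⟨o, mem_optimal.2 fun o' => ho ▸ payoff_le_maxPayoff U ε o'⟩

theorem maxPayoff_eq_of_mem_optimal {U : Z → ℝ} {ε : Option Z → ℝ} {o : Option Z}
    (h : o ∈ optimal U ε) : maxPayoff U ε = payoff U ε o :=
  le_antisymm (maxPayoff_le (mem_optimal.1 h)) (payoff_le_maxPayoff U ε o)

theorem measurableSet_optimal_eq (U : Z → ℝ) (A : Finset (Option Z)) :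
    MeasurableSet {ε | optimal U ε = A} := by
  have h : {ε | optimal U ε = A}
      = ⋂ o, {ε | (∀ o', payoff U ε o' ≤ payoff U ε o) ↔ o ∈ A} := by
    ext ε
    simp only [Set.mem_ofPred_eq, Set.mem_iInter, Finset.ext_iff, mem_optimal]
  rw [h]
  refine MeasurableSet.iInter fun o => ?_
  have h1 : MeasurableSet {ε | ∀ o', payoff U ε o' ≤ payoff U ε o} := by
    rw [Set.ofPred_forall]
    exact MeasurableSet.iInter fun o' => (isClosed_le (continuous_payoff U o')
      (continuous_payoff U o)).measurableSet
  by_cases ho : o ∈ A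
  · simpa only [ho, iff_true] using h1
  · simpa only [ho, iff_false, Set.compl_ofPred] using h1.compl

theorem tieRule_eq_sum (U : Z → ℝ) (w : Finset (Option Z) → Option Z → ℝ) (ε : Option Z → ℝ)
    (o : Option Z) :
    tieRule U w ε o = ∑ A, {ε | optimal U ε = A}.indicator (fun _ => w A o) ε := by
  classical
  simp [tieRule, Set.indicator_apply]

theorem isChoiceRule_tieRule (U : Z → ℝ) {w : Finset (Option Z) → Option Z → ℝ}
    (hw : w ∈ tieWeights Z) : IsChoiceRule (tieRule U w) where
  measurable := by
    refine measurable_pi_iff.2 fun o => ?_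
    simp only [tieRule_eq_sum]
    exact Finset.measurable_fun_sum _ fun A _ =>
      measurable_const.indicator (measurableSet_optimal_eq U A)
  nonneg ε o := (hw _ trivial).1.1 o
  sum_eq_one ε := (hw _ trivial).1.2

omit [IsProbabilityMeasure P] in
theorem isRational_tieRule (U : Z → ℝ) {w : Finset (Option Z) → Option Z → ℝ}
    (hw : w ∈ tieWeights Z) : IsRational P U (tieRule U w) :=
  ae_of_all _ fun ε _ o' h =>
    (hw _ trivial).2 (optimal_nonempty U ε) _ fun hmem => (mem_optimal.1 hmem o').not_gt h

theorem share_tieRule (U : Z → ℝ) (w : Finset (Option Z) → Option Z → ℝ) (z : Z) :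
    share P (tieRule U w) z = ∑ A, P.real {ε | optimal U ε = A} * w A (some z) := by
  simp only [share, tieRule_eq_sum]
  rw [integral_finsetSum _ fun A _ =>
    (integrable_const _).indicator (measurableSet_optimal_eq U A)]
  refine Finset.sum_congr rfl fun A _ => ?_
  rw [integral_indicator_const _ (measurableSet_optimal_eq U A), smul_eq_mul]

theorem isCompact_tieShares (U : Z → ℝ) : IsCompact (tieShares P U) := by
  refine IsCompact.image (isCompact_univ_pi fun A => ?_) ?_
  · refine (isCompact_stdSimplex ℝ (Option Z)).inter_right
      (t := {v | A.Nonempty → ∀ o ∉ A, v o = 0}) ?_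
    simp only [Set.ofPred_forall]
    exact isClosed_iInter fun _ => isClosed_iInter fun o => isClosed_iInter fun _ =>
      isClosed_eq (continuous_apply o) continuous_const
  · simp only [share_tieRule]
    fun_prop

theorem convex_tieShares (U : Z → ℝ) : Convex ℝ (tieShares P U) := by
  refine Convex.is_linear_image (convex_pi fun A _ => ?_) ⟨fun w w' => ?_, fun c w => ?_⟩
  · refine (convex_stdSimplex ℝ (Option Z)).inter (t := {v | A.Nonempty → ∀ o ∉ A, v o = 0}) ?_
    intro v hv v' hv' a b _ _ _ hA o ho
    simp [hv hA o ho, hv' hA o ho]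
  · ext z
    simp [share_tieRule, mul_add, Finset.sum_add_distrib]
  · ext z
    simp [share_tieRule, Finset.mul_sum, mul_left_comm]

/-- For small `t > 0`, an agent facing `U + t d` takes one of the options that are best in the
direction `d` among those that are optimal at `U`. -/
theorem eventually_maxPayoff_eq {U d : Z → ℝ} {ε : Option Z → ℝ} {o : Option Z}
    (ho : o ∈ optimal U ε) (hd : ∀ o' ∈ optimal U ε, o'.elim 0 d ≤ o.elim 0 d) :
    ∀ᶠ t in 𝓝[>] (0 : ℝ),
      maxPayoff (fun z => U z + t * d z) ε = maxPayoff U ε + t * o.elim 0 d := by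
  have hp : ∀ (t : ℝ) (o : Option Z),
      payoff (fun z => U z + t * d z) ε o = payoff U ε o + t * o.elim 0 d := by
    intro t o
    rw [payoff_add U fun z => t * d z]
    cases o <;> simp
  have h : ∀ o', ∀ᶠ t in 𝓝[>] (0 : ℝ),
      payoff U ε o' + t * o'.elim 0 d ≤ payoff U ε o + t * o.elim 0 d := by
    intro o'
    by_cases ho' : o' ∈ optimal U ε
    · filter_upwards [self_mem_nhdsWithin] with t ht
      have h1 := mul_le_mul_of_nonneg_left (hd o' ho') (le_of_lt ht)
      have h2 := mem_optimal.1 ho o'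
      linarith
    · have hlt : payoff U ε o' < payoff U ε o := by
        rw [mem_optimal] at ho'
        push Not at ho'
        obtain ⟨o₂, h₂⟩ := ho'
        exact h₂.trans_le (mem_optimal.1 ho o₂)
      have hc : ∀ o : Option Z,
          Tendsto (fun t : ℝ => payoff U ε o + t * o.elim 0 d) (𝓝[>] 0) (𝓝 (payoff U ε o)) := by
        intro o
        have : Continuous fun t : ℝ => payoff U ε o + t * o.elim 0 d := by fun_prop
        simpa using (this.tendsto 0).mono_left nhdsWithin_le_nhds
      filter_upwards [(hc o').eventually_lt (hc o) hlt] with t ht using ht.le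
  filter_upwards [eventually_all.2 h] with t ht
  refine le_antisymm (maxPayoff_le fun o' => ?_) ?_
  · rw [hp, maxPayoff_eq_of_mem_optimal ho]
    exact ht o'
  · rw [maxPayoff_eq_of_mem_optimal ho, ← hp]
    exact payoff_le_maxPayoff _ ε o

/-- The directional derivative of the expected indirect utility along `d` is the scalar product
of `d` with the shares that arise when agents break ties in favour of `d`. -/
theorem exists_tieShares_tendsto (hP : ∀ o, Integrable (fun ε : Option Z → ℝ => ε o) P)
    (U d : Z → ℝ) :
    ∃ q ∈ tieShares P U,
      Tendsto (fun t : ℝ => (indirectUtility P (fun z => U z + t * d z) - indirectUtility P U) / t)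
        (𝓝[>] 0) (𝓝 (∑ z, d z * q z)) := by
  classical
  have hsel : ∀ A : Finset (Option Z), ∃ o, A.Nonempty →
      o ∈ A ∧ ∀ o' ∈ A, o'.elim 0 d ≤ o.elim 0 d := by
    intro A
    by_cases hA : A.Nonempty
    · obtain ⟨o, ho, h⟩ := A.exists_max_image (fun o => o.elim 0 d) hA
      exact ⟨o, fun _ => ⟨ho, h⟩⟩
    · exact ⟨none, fun h => absurd h hA⟩
  choose sel hsel using hsel
  let w : Finset (Option Z) → Option Z → ℝ := fun A => Pi.single (sel A) 1
  have hw : w ∈ tieWeights Z := by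
    intro A _
    refine ⟨single_mem_stdSimplex ℝ (sel A), fun hA o ho => ?_⟩
    exact Pi.single_eq_of_ne (fun h => ho (by rw [h]; exact (hsel A hA).1)) _
  have hrule := isChoiceRule_tieRule U hw
  refine ⟨_, ⟨w, hw, rfl⟩, ?_⟩
  have hlim : ∑ z, d z * share P (tieRule U w) z
      = ∫ ε, (sel (optimal U ε)).elim 0 d ∂P := by
    simp only [share, ← integral_const_mul]
    rw [← integral_finsetSum _ fun z _ => (hrule.integrable (some z)).const_mul _]
    refine integral_congr_ae (ae_of_all _ fun ε => ?_)
    simp only [tieRule, w]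
    cases sel (optimal U ε) <;> simp [Pi.single_apply]
  rw [hlim]
  have hquot : ∀ t : ℝ,
      (indirectUtility P (fun z => U z + t * d z) - indirectUtility P U) / t
        = ∫ ε, (maxPayoff (fun z => U z + t * d z) ε - maxPayoff U ε) / t ∂P := by
    intro t
    rw [integral_div, integral_sub (integrable_maxPayoff hP _) (integrable_maxPayoff hP _)]
    rfl
  simp only [hquot]
  refine tendsto_integral_filter_of_dominated_convergence (fun _ => ‖d‖) ?_ ?_
    (integrable_const _) (ae_of_all _ fun ε => ?_)
  · exact Eventually.of_forall fun t => (((continuous_maxPayoff _).sub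
      (continuous_maxPayoff U)).div_const t).aestronglyMeasurable
  · filter_upwards [self_mem_nhdsWithin] with t ht
    refine ae_of_all _ fun ε => ?_
    have ht' : 0 < t := ht
    have hdist : dist (fun z => U z + t * d z) U = t * ‖d‖ := by
      rw [dist_eq_norm]
      have : (fun z => U z + t * d z) - U = t • d := by
        ext z
        simp
      rw [this, norm_smul, Real.norm_of_nonneg ht'.le]
    have h1 := maxPayoff_le_add_dist (fun z => U z + t * d z) U ε
    have h2 := maxPayoff_le_add_dist U (fun z => U z + t * d z) ε
    rw [dist_comm] at h2
    rw [hdist] at h1 h2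
    rw [norm_div, Real.norm_eq_abs, Real.norm_of_nonneg ht'.le, div_le_iff₀ ht', abs_le]
    constructor <;> linarith
  · refine tendsto_const_nhds.congr' ?_
    have hs := hsel _ (optimal_nonempty U ε)
    filter_upwards [eventually_maxPayoff_eq hs.1 hs.2, self_mem_nhdsWithin] with t h ht
    have ht' : t ≠ 0 := (show 0 < t from ht).ne'
    rw [h]
    field_simp
    ring

/-! ### The convex conjugate -/

/-- At a vector of shares `q`, the conjugate is a real number `c`, to which the Fenchel inequality
applies. -/
theorem IsChoiceRule.exists_conjugate_eq {σ : (Option Z → ℝ) → Option Z → ℝ}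
    (hσ : IsChoiceRule σ) (hP : ∀ o, Integrable (fun ε : Option Z → ℝ => ε o) P) :
    ∃ c : ℝ, conjugate P (share P σ) = c ∧
      (∀ U, ∑ z, share P σ z * U z - indirectUtility P U ≤ c) ∧
      (∀ U, IsRational P U σ → c = ∑ z, share P σ z * U z - indirectUtility P U) := by
  have hmean : ∀ U, meanPayoff P U σ
      = meanPayoff P (fun _ => 0) σ + ∑ z, share P σ z * U z := by
    intro U
    have := hσ.meanPayoff_add hP (fun _ => 0) U
    simpa only [zero_add, mul_comm] using this
  have hle : conjugate P (share P σ) ≤ ((-meanPayoff P (fun _ => 0) σ : ℝ) : EReal) := by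
    rw [conjugate, if_pos hσ.sum_share_le_one]
    refine iSup_le fun U => EReal.coe_le_coe_iff.2 ?_
    linarith [hmean U, hσ.meanPayoff_le hP U]
  have hge : ∀ U, ((∑ z, share P σ z * U z - indirectUtility P U : ℝ) : EReal)
      ≤ conjugate P (share P σ) := by
    intro U
    rw [conjugate, if_pos hσ.sum_share_le_one]
    exact le_iSup (fun U : Z → ℝ =>
      ((∑ z, share P σ z * U z - indirectUtility P U : ℝ) : EReal)) U
  have hc := EReal.coe_toReal (hle.trans_lt (EReal.coe_lt_top _)).ne
    ((EReal.bot_lt_coe _).trans_le (hge 0)).ne'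
  rw [← hc] at hle hge
  simp only [EReal.coe_le_coe_iff] at hle hge
  refine ⟨_, hc.symm, hge, fun U hU => le_antisymm ?_ (hge U)⟩
  linarith [hmean U, hU.meanPayoff_eq hσ]

/-- Every nonnegative vector with sum at most one is a vector of shares: let the choice not
depend on the shock. -/
theorem exists_share_eq {q : Z → ℝ} (h0 : ∀ z, 0 ≤ q z) (h1 : ∑ z, q z ≤ 1) :
    ∃ σ, IsChoiceRule σ ∧ share P σ = q := by
  refine ⟨fun _ o => o.elim (1 - ∑ z, q z) q, IsChoiceRule.const (fun o => ?_) ?_, ?_⟩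
  · cases o
    · simpa using h1
    · exact h0 _
  · rw [Fintype.sum_option]
    simp
  · ext z
    simp [share]

/-! ### No ties -/

omit [Fintype Z] [IsProbabilityMeasure P] in
theorem NoTies.ae_payoff_ne [Finite Z] (h : NoTies P) (U : Z → ℝ) :
    ∀ᵐ ε ∂P, ∀ o o' : Option Z, o ≠ o' → payoff U ε o ≠ payoff U ε o' := by
  rw [ae_all_iff]
  intro o
  rw [ae_all_iff]
  intro o'
  rw [eventually_imp_distrib_left]
  intro hne
  rw [ae_iff]
  convert h o o' hne (o'.elim 0 U - o.elim 0 U) using 2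
  ext ε
  simp only [payoff, ne_eq, not_not, Set.mem_ofPred_eq]
  constructor <;> intro h <;> linarith

omit [IsProbabilityMeasure P] in
/-- Without ties, two rational choice rules generate the same shares. -/
theorem NoTies.share_eq (h : NoTies P) {U : Z → ℝ} {σ τ : (Option Z → ℝ) → Option Z → ℝ}
    (hσ : IsChoiceRule σ) (hτ : IsChoiceRule τ) (hσU : IsRational P U σ)
    (hτU : IsRational P U τ) : share P σ = share P τ := by
  ext z
  refine integral_congr_ae ?_
  filter_upwards [h.ae_payoff_ne U, hσU, hτU] with ε hne hs ht
  obtain ⟨o, ho⟩ := optimal_nonempty U ε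
  have hlt : ∀ o', o' ≠ o → payoff U ε o' < payoff U ε o := fun o' h' =>
    (mem_optimal.1 ho o').lt_of_ne (hne o' o h')
  by_cases hz : some z = o
  · have hs1 := hσ.sum_eq_one ε
    have ht1 := hτ.sum_eq_one ε
    rw [Finset.sum_eq_single o (fun o' _ h' => hs o' o (hlt o' h')) (by simp)] at hs1
    rw [Finset.sum_eq_single o (fun o' _ h' => ht o' o (hlt o' h')) (by simp)] at ht1
    rw [hz, hs1, ht1]
  · rw [hs _ o (hlt _ hz), ht _ o (hlt _ hz)]

/-- Without ties, the expected indirect utility is differentiable: its only subgradient at `U` is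
the vector of shares of a rational choice rule. -/
theorem NoTies.eq_share_of_subgradient (h : NoTies P)
    (hP : ∀ o, Integrable (fun ε : Option Z → ℝ => ε o) P) {U q : Z → ℝ}
    (hq : ∀ V, ∑ z, q z * V z - indirectUtility P V ≤ ∑ z, q z * U z - indirectUtility P U)
    {σ : (Option Z → ℝ) → Option Z → ℝ} (hσ : IsChoiceRule σ) (hσU : IsRational P U σ) :
    q = share P σ := by
  classical
  have key : ∀ d : Z → ℝ, ∑ z, d z * q z ≤ ∑ z, d z * share P σ z := by
    intro d
    obtain ⟨r, ⟨w, hw, rfl⟩, hlim⟩ := exists_tieShares_tendsto hP U d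
    rw [h.share_eq hσ (isChoiceRule_tieRule U hw) hσU (isRational_tieRule U hw)]
    refine ge_of_tendsto hlim ?_
    filter_upwards [self_mem_nhdsWithin] with t ht
    rw [le_div_iff₀ ht]
    have h1 := hq fun z => U z + t * d z
    have h2 : ∑ z, q z * (U z + t * d z) = ∑ z, q z * U z + (∑ z, d z * q z) * t := by
      rw [Finset.sum_mul, ← Finset.sum_add_distrib]
      exact Finset.sum_congr rfl fun z _ => by ring
    linarith
  ext z
  refine le_antisymm ?_ ?_
  · simpa [Pi.single_apply] using key (Pi.single z 1)
  · simpa [Finset.sum_neg_distrib, Pi.single_apply] using key (-Pi.single z 1)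

end OneSide


/-! ### Weak duality -/

theorem coe_sum_ereal {ι : Type*} (s : Finset ι) (f : ι → ℝ) :
    ((∑ i ∈ s, f i : ℝ) : EReal) = ∑ i ∈ s, (f i : EReal) :=
  map_sum (⟨⟨Real.toEReal, EReal.coe_zero⟩, EReal.coe_add⟩ : ℝ →+ EReal) f s

namespace Economy

variable {X Y Z : Type*} [Fintype X] [Fintype Y] [Fintype Z]

/-- The standing assumptions: positive masses, and shocks with finite expectations. -/
structure IsRegular (E : Economy X Y Z) : Prop where
  n_pos : ∀ x, 0 < E.n x
  m_pos : ∀ y, 0 < E.m y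
  prob_P : ∀ x, IsProbabilityMeasure (E.P x)
  prob_Q : ∀ y, IsProbabilityMeasure (E.Q y)
  integrable_P : ∀ x o, Integrable (fun ε : Option Z → ℝ => ε o) (E.P x)
  integrable_Q : ∀ y o, Integrable (fun ε : Option Z → ℝ => ε o) (E.Q y)

variable {E : Economy X Y Z}

/-- Payments cancel in an allocation: its welfare may be computed at any prices. -/
theorem IsAllocation.welfare_eq (hE : E.IsRegular)
    {σ : X → (Option Z → ℝ) → Option Z → ℝ} {τ : Y → (Option Z → ℝ) → Option Z → ℝ}
    (h : E.IsAllocation σ τ) (p : Z → ℝ) :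
    E.welfare σ τ = ∑ x, E.n x * meanPayoff (E.P x) (fun z => E.α x z + p z) (σ x)
      + ∑ y, E.m y * meanPayoff (E.Q y) (fun z => E.γ z y - p z) (τ y) := by
  have := hE.prob_P
  have := hE.prob_Q
  have h1 : ∀ x, meanPayoff (E.P x) (fun z => E.α x z + p z) (σ x)
      = meanPayoff (E.P x) (E.α x) (σ x) + ∑ z, p z * share (E.P x) (σ x) z := fun x =>
    (h.producers x).meanPayoff_add (hE.integrable_P x) (E.α x) p
  have h2 : ∀ y, meanPayoff (E.Q y) (fun z => E.γ z y - p z) (τ y)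
      = meanPayoff (E.Q y) (fun z => E.γ z y) (τ y)
        - ∑ z, p z * share (E.Q y) (τ y) z := by
    intro y
    have := (h.consumers y).meanPayoff_add (hE.integrable_Q y) (fun z => E.γ z y)
      (fun z => -p z)
    simpa only [← sub_eq_add_neg, neg_mul, Finset.sum_neg_distrib] using this
  have h3 : ∑ x, E.n x * ∑ z, p z * share (E.P x) (σ x) z
      = ∑ y, E.m y * ∑ z, p z * share (E.Q y) (τ y) z := by
    simp only [Finset.mul_sum, mul_left_comm _ (p _)]
    rw [Finset.sum_comm, Finset.sum_comm (s := (Finset.univ : Finset Y))]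
    simp only [← Finset.mul_sum, h.clearing]
  simp only [h1, h2, mul_add, mul_sub, Finset.sum_add_distrib, Finset.sum_sub_distrib, h3,
    welfare]
  ring

theorem IsAllocation.welfare_le (hE : E.IsRegular)
    {σ : X → (Option Z → ℝ) → Option Z → ℝ} {τ : Y → (Option Z → ℝ) → Option Z → ℝ}
    (h : E.IsAllocation σ τ) (p : Z → ℝ) : E.welfare σ τ ≤ E.totalSurplus p := by
  have := hE.prob_P
  have := hE.prob_Q
  rw [h.welfare_eq hE p]
  refine add_le_add (Finset.sum_le_sum fun x _ => ?_) (Finset.sum_le_sum fun y _ => ?_)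
  · exact mul_le_mul_of_nonneg_left ((h.producers x).meanPayoff_le (hE.integrable_P x) _)
      (hE.n_pos x).le
  · exact mul_le_mul_of_nonneg_left ((h.consumers y).meanPayoff_le (hE.integrable_Q y) _)
      (hE.m_pos y).le

theorem IsAllocation.welfare_eq_totalSurplus (hE : E.IsRegular)
    {σ : X → (Option Z → ℝ) → Option Z → ℝ} {τ : Y → (Option Z → ℝ) → Option Z → ℝ}
    (h : E.IsAllocation σ τ) {p : Z → ℝ}
    (hσ : ∀ x, IsRational (E.P x) (fun z => E.α x z + p z) (σ x))
    (hτ : ∀ y, IsRational (E.Q y) (fun z => E.γ z y - p z) (τ y)) :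
    E.welfare σ τ = E.totalSurplus p := by
  rw [h.welfare_eq hE p]
  simp only [fun x => (hσ x).meanPayoff_eq (h.producers x),
    fun y => (hτ y).meanPayoff_eq (h.consumers y), totalSurplus]

/-- The loss of the producers of type `x` in the Fenchel inequality at prices `p`, when their
conjugate has the value `c`. -/
noncomputable def supplyGap (E : Economy X Y Z) (μ : X → Z → ℝ) (p : Z → ℝ) (x : X) (c : ℝ) : ℝ :=
  c - (∑ z, μ x z / E.n x * (E.α x z + p z)
    - indirectUtility (E.P x) (fun z => E.α x z + p z))

/-- The loss of the consumers of type `y` in the Fenchel inequality at prices `p`, when their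
conjugate has the value `c`. -/
noncomputable def demandGap (E : Economy X Y Z) (ν : Z → Y → ℝ) (p : Z → ℝ) (y : Y) (c : ℝ) : ℝ :=
  c - (∑ z, ν z y / E.m y * (E.γ z y - p z)
    - indirectUtility (E.Q y) (fun z => E.γ z y - p z))

theorem IsFeasible.exists_share_supply (hE : E.IsRegular) {μ : X → Z → ℝ} {ν : Z → Y → ℝ}
    (h : E.IsFeasible μ ν) (x : X) :
    ∃ σ, IsChoiceRule σ ∧ share (E.P x) σ = fun z => μ x z / E.n x := by
  have := hE.prob_P
  refine exists_share_eq (fun z => div_nonneg (h.supply_nonneg x z) (hE.n_pos x).le) ?_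
  rw [← Finset.sum_div]
  exact div_le_one_of_le₀ (h.producers_le x) (hE.n_pos x).le

theorem IsFeasible.exists_share_demand (hE : E.IsRegular) {μ : X → Z → ℝ} {ν : Z → Y → ℝ}
    (h : E.IsFeasible μ ν) (y : Y) :
    ∃ τ, IsChoiceRule τ ∧ share (E.Q y) τ = fun z => ν z y / E.m y := by
  have := hE.prob_Q
  refine exists_share_eq (fun z => div_nonneg (h.demand_nonneg z y) (hE.m_pos y).le) ?_
  rw [← Finset.sum_div]
  exact div_le_one_of_le₀ (h.consumers_le y) (hE.m_pos y).le

/-- For feasible quantities the conjugates are real numbers, and the duality gap at prices `p`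
is the weighted sum of the gaps in the Fenchel inequalities of all types. -/
theorem IsFeasible.exists_quantityObjective_eq (hE : E.IsRegular) {μ : X → Z → ℝ}
    {ν : Z → Y → ℝ} (h : E.IsFeasible μ ν) :
    ∃ (c : X → ℝ) (e : Y → ℝ),
      (∀ x, conjugate (E.P x) (fun z => μ x z / E.n x) = c x) ∧
      (∀ y, conjugate (E.Q y) (fun z => ν z y / E.m y) = e y) ∧
      (∀ x U, ∑ z, μ x z / E.n x * U z - indirectUtility (E.P x) U ≤ c x) ∧
      (∀ y V, ∑ z, ν z y / E.m y * V z - indirectUtility (E.Q y) V ≤ e y) ∧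
      ∀ p, E.quantityObjective μ ν = ((E.totalSurplus p - (∑ x, E.n x * E.supplyGap μ p x (c x)
        + ∑ y, E.m y * E.demandGap ν p y (e y)) : ℝ) : EReal) := by
  have := hE.prob_P
  have := hE.prob_Q
  have hX : ∀ x, ∃ c : ℝ, conjugate (E.P x) (fun z => μ x z / E.n x) = c ∧
      ∀ U, ∑ z, μ x z / E.n x * U z - indirectUtility (E.P x) U ≤ c := by
    intro x
    obtain ⟨σ, hσ, hs⟩ := h.exists_share_supply hE x
    obtain ⟨c, hc, hU, -⟩ := hσ.exists_conjugate_eq (hE.integrable_P x)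
    rw [hs] at hc hU
    exact ⟨c, hc, hU⟩
  have hY : ∀ y, ∃ e : ℝ, conjugate (E.Q y) (fun z => ν z y / E.m y) = e ∧
      ∀ V, ∑ z, ν z y / E.m y * V z - indirectUtility (E.Q y) V ≤ e := by
    intro y
    obtain ⟨σ, hσ, hs⟩ := h.exists_share_demand hE y
    obtain ⟨c, hc, hU, -⟩ := hσ.exists_conjugate_eq (hE.integrable_Q y)
    rw [hs] at hc hU
    exact ⟨c, hc, hU⟩
  choose c hc hU using hX
  choose e he hV using hY
  refine ⟨c, e, hc, he, hU, hV, fun p => ?_⟩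
  simp only [quantityObjective, entropy, hc, he, ← EReal.coe_mul, ← coe_sum_ereal,
    ← EReal.coe_add, ← EReal.coe_sub, EReal.coe_eq_coe_iff]
  have h1 : ∀ x, E.n x * E.supplyGap μ p x (c x)
      = E.n x * c x - ∑ z, μ x z * E.α x z - ∑ z, p z * μ x z
        + E.n x * indirectUtility (E.P x) (fun z => E.α x z + p z) := by
    intro x
    have : E.n x * ∑ z, μ x z / E.n x * (E.α x z + p z)
        = ∑ z, μ x z * E.α x z + ∑ z, p z * μ x z := by
      rw [Finset.mul_sum, ← Finset.sum_add_distrib]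
      refine Finset.sum_congr rfl fun z _ => ?_
      have := (hE.n_pos x).ne'
      field_simp
    rw [supplyGap, mul_sub, mul_sub, this]
    ring
  have h2 : ∀ y, E.m y * E.demandGap ν p y (e y)
      = E.m y * e y - ∑ z, ν z y * E.γ z y + ∑ z, p z * ν z y
        + E.m y * indirectUtility (E.Q y) (fun z => E.γ z y - p z) := by
    intro y
    have : E.m y * ∑ z, ν z y / E.m y * (E.γ z y - p z)
        = ∑ z, ν z y * E.γ z y - ∑ z, p z * ν z y := by
      rw [Finset.mul_sum, ← Finset.sum_sub_distrib]
      refine Finset.sum_congr rfl fun z _ => ?_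
      have := (hE.m_pos y).ne'
      field_simp
    rw [demandGap, mul_sub, mul_sub, this]
    ring
  have h3 : ∑ x, ∑ z, p z * μ x z = ∑ y, ∑ z, p z * ν z y := by
    rw [Finset.sum_comm, Finset.sum_comm (s := (Finset.univ : Finset Y))]
    simp only [← Finset.mul_sum, h.clearing]
  simp only [h1, h2, Finset.sum_add_distrib, Finset.sum_sub_distrib, h3, totalSurplus]
  ring

theorem IsFeasible.quantityObjective_le (hE : E.IsRegular) {μ : X → Z → ℝ} {ν : Z → Y → ℝ}
    (h : E.IsFeasible μ ν) (p : Z → ℝ) : E.quantityObjective μ ν ≤ E.totalSurplus p := by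
  obtain ⟨c, e, -, -, hU, hV, hobj⟩ := h.exists_quantityObjective_eq hE
  rw [hobj p, EReal.coe_le_coe_iff]
  have h1 : 0 ≤ ∑ x, E.n x * E.supplyGap μ p x (c x) := Finset.sum_nonneg fun x _ =>
    mul_nonneg (hE.n_pos x).le (sub_nonneg.2 (hU x _))
  have h2 : 0 ≤ ∑ y, E.m y * E.demandGap ν p y (e y) := Finset.sum_nonneg fun y _ =>
    mul_nonneg (hE.m_pos y).le (sub_nonneg.2 (hV y _))
  linarith

/-- At an equilibrium there is no duality gap. -/
theorem IsEquilibrium.quantityObjective_eq (hE : E.IsRegular) {p : Z → ℝ} {μ : X → Z → ℝ}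
    {ν : Z → Y → ℝ} (h : E.IsEquilibrium p μ ν) :
    E.quantityObjective μ ν = E.totalSurplus p := by
  have := hE.prob_P
  have := hE.prob_Q
  obtain ⟨c, e, hc, he, -, -, hobj⟩ := h.feasible.exists_quantityObjective_eq hE
  have h1 : ∀ x, E.supplyGap μ p x (c x) = 0 := by
    intro x
    obtain ⟨σ, hσ, hr, hs⟩ := h.producers x
    have hq : share (E.P x) σ = fun z => μ x z / E.n x := by
      ext z
      rw [hs, mul_div_cancel_left₀ _ (hE.n_pos x).ne']
    obtain ⟨c', hc', -, heq⟩ := hσ.exists_conjugate_eq (hE.integrable_P x)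
    rw [hq, hc x, EReal.coe_eq_coe_iff] at hc'
    rw [supplyGap, hc', heq _ hr, hq, sub_self]
  have h2 : ∀ y, E.demandGap ν p y (e y) = 0 := by
    intro y
    obtain ⟨τ, hτ, hr, hs⟩ := h.consumers y
    have hq : share (E.Q y) τ = fun z => ν z y / E.m y := by
      ext z
      rw [hs, mul_div_cancel_left₀ _ (hE.m_pos y).ne']
    obtain ⟨c', hc', -, heq⟩ := hτ.exists_conjugate_eq (hE.integrable_Q y)
    rw [hq, he y, EReal.coe_eq_coe_iff] at hc'
    rw [demandGap, hc', heq _ hr, hq, sub_self]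
  rw [hobj p]
  simp [h1, h2]

/-! ### Minimal total surplus -/

theorem continuous_totalSurplus (hE : E.IsRegular) : Continuous E.totalSurplus := by
  have := hE.prob_P
  have := hE.prob_Q
  unfold totalSurplus
  refine Continuous.add (continuous_finsetSum _ fun x _ => continuous_const.mul ?_)
    (continuous_finsetSum _ fun y _ => continuous_const.mul ?_)
  · exact (continuous_indirectUtility (hE.integrable_P x)).comp (by fun_prop)
  · exact (continuous_indirectUtility (hE.integrable_Q y)).comp (by fun_prop)

/-- The total surplus is coercive: when a price is high, producers of any type gain from producing
that quality, when it is very negative, consumers gain from consuming it, and the others can stay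
out of the market. -/
theorem exists_forall_totalSurplus_le (hE : E.IsRegular) [Nonempty X] [Nonempty Y] :
    ∃ p, ∀ p', E.totalSurplus p ≤ E.totalSurplus p' := by
  classical
  have := hE.prob_P
  have := hE.prob_Q
  obtain ⟨x₀⟩ := ‹Nonempty X›
  obtain ⟨y₀⟩ := ‹Nonempty Y›
  let a : X → ℝ := fun x => E.n x * ∫ ε, ε none ∂E.P x
  let b : Y → ℝ := fun y => E.m y * ∫ ε, ε none ∂E.Q y
  have ha : ∀ (p : Z → ℝ) x, a x ≤ E.n x * indirectUtility (E.P x) (fun z => E.α x z + p z) := by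
    intro p x
    refine mul_le_mul_of_nonneg_left ?_ (hE.n_pos x).le
    simpa using le_indirectUtility (hE.integrable_P x) (fun z => E.α x z + p z) none
  have hb : ∀ (p : Z → ℝ) y, b y ≤ E.m y * indirectUtility (E.Q y) (fun z => E.γ z y - p z) := by
    intro p y
    refine mul_le_mul_of_nonneg_left ?_ (hE.m_pos y).le
    simpa using le_indirectUtility (hE.integrable_Q y) (fun z => E.γ z y - p z) none
  -- `hi` and `lo` come from solving lower bounds of the total surplus, linear in a price.
  let hi : Z → ℝ := fun z => (E.totalSurplus 0 - (∑ x ∈ Finset.univ.erase x₀, a x + ∑ y, b y))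
    / E.n x₀ - E.α x₀ z - ∫ ε, ε (some z) ∂E.P x₀
  let lo : Z → ℝ := fun z => -((E.totalSurplus 0 - (∑ x, a x + ∑ y ∈ Finset.univ.erase y₀, b y))
    / E.m y₀ - E.γ z y₀ - ∫ ε, ε (some z) ∂E.Q y₀)
  have hbox : ∀ p, E.totalSurplus p ≤ E.totalSurplus 0 → p ∈ Set.Icc lo hi := by
    intro p hp
    refine ⟨fun z => ?_, fun z => ?_⟩
    · have h1 := le_indirectUtility (hE.integrable_Q y₀) (fun z => E.γ z y₀ - p z) (some z)
      have h2 : E.m y₀ * indirectUtility (E.Q y₀) (fun z => E.γ z y₀ - p z)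
          ≤ E.totalSurplus 0 - (∑ x, a x + ∑ y ∈ Finset.univ.erase y₀, b y) := by
        have h3 : ∑ x, a x ≤ _ := Finset.sum_le_sum fun x _ => ha p x
        have h4 : ∑ y ∈ Finset.univ.erase y₀, b y ≤ _ := Finset.sum_le_sum fun y _ => hb p y
        have h5 := Finset.add_sum_erase Finset.univ
          (fun y => E.m y * indirectUtility (E.Q y) (fun z => E.γ z y - p z))
          (Finset.mem_univ y₀)
        rw [totalSurplus] at hp
        linarith
      rw [← le_div_iff₀' (hE.m_pos y₀)] at h2
      simp only [Option.elim_some] at h1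
      simp only [lo]
      linarith
    · have h1 := le_indirectUtility (hE.integrable_P x₀) (fun z => E.α x₀ z + p z) (some z)
      have h2 : E.n x₀ * indirectUtility (E.P x₀) (fun z => E.α x₀ z + p z)
          ≤ E.totalSurplus 0 - (∑ x ∈ Finset.univ.erase x₀, a x + ∑ y, b y) := by
        have h3 : ∑ x ∈ Finset.univ.erase x₀, a x ≤ _ := Finset.sum_le_sum fun x _ => ha p x
        have h4 : ∑ y, b y ≤ _ := Finset.sum_le_sum fun y _ => hb p y
        have h5 := Finset.add_sum_erase Finset.univ
          (fun x => E.n x * indirectUtility (E.P x) (fun z => E.α x z + p z))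
          (Finset.mem_univ x₀)
        rw [totalSurplus] at hp
        linarith
      rw [← le_div_iff₀' (hE.n_pos x₀)] at h2
      simp only [Option.elim_some] at h1
      simp only [hi]
      linarith
  obtain ⟨p, -, hp⟩ := isCompact_Icc.exists_isMinOn ⟨0, hbox 0 le_rfl⟩
    (continuous_totalSurplus hE).continuousOn
  refine ⟨p, fun p' => ?_⟩
  by_cases hp' : E.totalSurplus p' ≤ E.totalSurplus 0
  · exact hp (hbox p' hp')
  · exact (hp (hbox 0 le_rfl)).trans (not_le.1 hp').le

theorem totalSurplus_midpoint_lt (hE : E.IsRegular) [Nonempty X]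
    (hsupp : ∀ x, (E.P x).IsOpenPosMeasure) {p p' : Z → ℝ} (hne : p ≠ p') :
    E.totalSurplus (fun z => (p z + p' z) / 2)
      < (E.totalSurplus p + E.totalSurplus p') / 2 := by
  have := hE.prob_P
  have := hE.prob_Q
  have hX : ∀ x, E.n x * indirectUtility (E.P x) (fun z => E.α x z + (p z + p' z) / 2)
      < E.n x * ((indirectUtility (E.P x) (fun z => E.α x z + p z)
        + indirectUtility (E.P x) (fun z => E.α x z + p' z)) / 2) := by
    intro x
    refine mul_lt_mul_of_pos_left ?_ (hE.n_pos x)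
    have hmid : (fun z => E.α x z + (p z + p' z) / 2)
        = fun z => ((E.α x z + p z) + (E.α x z + p' z)) / 2 := by
      ext z
      ring
    rw [hmid]
    refine indirectUtility_midpoint_lt (hE.integrable_P x) fun h => hne ?_
    ext z
    exact add_left_cancel (congrFun h z)
  have hY : ∀ y, E.m y * indirectUtility (E.Q y) (fun z => E.γ z y - (p z + p' z) / 2)
      ≤ E.m y * ((indirectUtility (E.Q y) (fun z => E.γ z y - p z)
        + indirectUtility (E.Q y) (fun z => E.γ z y - p' z)) / 2) := by
    intro y
    refine mul_le_mul_of_nonneg_left ?_ (hE.m_pos y).le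
    have hmid : (fun z => E.γ z y - (p z + p' z) / 2)
        = fun z => ((E.γ z y - p z) + (E.γ z y - p' z)) / 2 := by
      ext z
      ring
    rw [hmid]
    exact indirectUtility_midpoint_le (hE.integrable_Q y) _ _
  have h1 := Finset.sum_lt_sum_of_nonempty Finset.univ_nonempty fun x _ => hX x
  have h2 := Finset.sum_le_sum fun y (_ : y ∈ Finset.univ) => hY y
  simp only [mul_div_assoc', mul_add, ← Finset.sum_div, Finset.sum_add_distrib] at h1 h2
  simp only [totalSurplus]
  linarith

/-! ### Existence of equilibria -/

/-- If `p` minimizes the total surplus, ties can be broken so that all markets clear. Otherwise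
a hyperplane separates the compact convex set of the excess supplies from zero, and the total
surplus has a negative derivative along its normal. -/
theorem exists_tieShares_clearing (hE : E.IsRegular) {p : Z → ℝ}
    (hp : ∀ p', E.totalSurplus p ≤ E.totalSurplus p') :
    ∃ (q : X → Z → ℝ) (r : Y → Z → ℝ),
      (∀ x, q x ∈ tieShares (E.P x) (fun z => E.α x z + p z)) ∧
      (∀ y, r y ∈ tieShares (E.Q y) (fun z => E.γ z y - p z)) ∧
      ∀ z, ∑ x, E.n x * q x z = ∑ y, E.m y * r y z := by
  classical
  have := hE.prob_P
  have := hE.prob_Q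
  let K : Set ((X → Z → ℝ) × (Y → Z → ℝ)) :=
    (Set.univ.pi fun x => tieShares (E.P x) (fun z => E.α x z + p z)) ×ˢ
      (Set.univ.pi fun y => tieShares (E.Q y) (fun z => E.γ z y - p z))
  let T : (X → Z → ℝ) × (Y → Z → ℝ) → Z → ℝ := fun s z =>
    ∑ x, E.n x * s.1 x z - ∑ y, E.m y * s.2 y z
  have hT : IsLinearMap ℝ T := by
    constructor
    · intro s s'
      ext z
      simp only [T, Prod.fst_add, Prod.snd_add, Pi.add_apply, mul_add, Finset.sum_add_distrib]
      ring
    · intro c s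
      ext z
      simp only [T, Prod.smul_fst, Prod.smul_snd, Pi.smul_apply, smul_eq_mul, mul_sub,
        Finset.mul_sum, mul_left_comm c]
  have hcomp : IsCompact (T '' K) :=
    ((isCompact_univ_pi fun x => isCompact_tieShares _).prod
      (isCompact_univ_pi fun y => isCompact_tieShares _)).image (by fun_prop)
  have hconv : Convex ℝ (T '' K) :=
    ((convex_pi fun x _ => convex_tieShares _).prod
      (convex_pi fun y _ => convex_tieShares _)).is_linear_image hT
  suffices h0 : (0 : Z → ℝ) ∈ T '' K by
    obtain ⟨⟨q, r⟩, ⟨hq, hr⟩, hz⟩ := h0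
    exact ⟨q, r, fun x => hq x trivial, fun y => hr y trivial,
      fun z => sub_eq_zero.1 (congrFun hz z)⟩
  by_contra h0
  obtain ⟨f, u, hf0, hfK⟩ := geometric_hahn_banach_point_closed hconv hcomp.isClosed h0
  let d : Z → ℝ := fun z => f fun j => if z = j then 1 else 0
  have hfd : ∀ s, f s = ∑ z, s z * d z := fun s =>
    LinearMap.pi_apply_eq_sum_univ (f : (Z → ℝ) →ₗ[ℝ] ℝ) s
  -- The separating functional is positive on `T '' K`, so the direction to consider is `-d`.
  choose q hq hqlim using fun x => exists_tieShares_tendsto (hE.integrable_P x)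
    (fun z => E.α x z + p z) (fun z => -d z)
  choose r hr hrlim using fun y => exists_tieShares_tendsto (hE.integrable_Q y)
    (fun z => E.γ z y - p z) d
  have hlim : Tendsto (fun t : ℝ => (E.totalSurplus (fun z => p z - t * d z)
      - E.totalSurplus p) / t) (𝓝[>] 0)
      (𝓝 (∑ x, E.n x * ∑ z, -d z * q x z + ∑ y, E.m y * ∑ z, d z * r y z)) := by
    refine ((tendsto_finsetSum _ fun x _ => (hqlim x).const_mul (E.n x)).add
      (tendsto_finsetSum _ fun y _ => (hrlim y).const_mul (E.m y))).congr fun t => ?_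
    have hs : ∀ x, (fun z => E.α x z + (p z - t * d z))
        = fun z => E.α x z + p z + t * -d z := fun x => by
      ext z
      ring
    have hc : ∀ y, (fun z => E.γ z y - (p z - t * d z))
        = fun z => E.γ z y - p z + t * d z := fun y => by
      ext z
      ring
    simp only [totalSurplus, hs, hc, mul_div_assoc', mul_sub, ← Finset.sum_div,
      Finset.sum_sub_distrib]
    ring
  have hnonneg : 0 ≤ ∑ x, E.n x * ∑ z, -d z * q x z + ∑ y, E.m y * ∑ z, d z * r y z := by
    refine ge_of_tendsto hlim ?_
    filter_upwards [self_mem_nhdsWithin] with t ht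
    exact div_nonneg (sub_nonneg.2 (hp _)) (le_of_lt ht)
  have hpos : u < f (T (q, r)) :=
    hfK _ ⟨(q, r), ⟨fun x _ => hq x, fun y _ => hr y⟩, rfl⟩
  have hval : f (T (q, r))
      = -(∑ x, E.n x * ∑ z, -d z * q x z + ∑ y, E.m y * ∑ z, d z * r y z) := by
    have h1 : ∑ z, ∑ x, E.n x * q x z * d z = ∑ x, ∑ z, E.n x * (d z * q x z) := by
      rw [Finset.sum_comm]
      exact Finset.sum_congr rfl fun x _ => Finset.sum_congr rfl fun z _ => by ring
    have h2 : ∑ z, ∑ y, E.m y * r y z * d z = ∑ y, ∑ z, E.m y * (d z * r y z) := by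
      rw [Finset.sum_comm]
      exact Finset.sum_congr rfl fun y _ => Finset.sum_congr rfl fun z _ => by ring
    rw [hfd]
    simp only [T, sub_mul, Finset.sum_sub_distrib, Finset.sum_mul, Finset.mul_sum, h1, h2,
      neg_mul, mul_neg, Finset.sum_neg_distrib]
    ring
  rw [map_zero] at hf0
  linarith

theorem exists_rational_allocation (hE : E.IsRegular) {p : Z → ℝ}
    (hp : ∀ p', E.totalSurplus p ≤ E.totalSurplus p') :
    ∃ σ τ, E.IsAllocation σ τ ∧
      (∀ x, IsRational (E.P x) (fun z => E.α x z + p z) (σ x)) ∧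
      ∀ y, IsRational (E.Q y) (fun z => E.γ z y - p z) (τ y) := by
  obtain ⟨q, r, hq, hr, hz⟩ := exists_tieShares_clearing hE hp
  choose w hw hwq using hq
  choose v hv hvr using hr
  refine ⟨fun x => tieRule (fun z => E.α x z + p z) (w x),
    fun y => tieRule (fun z => E.γ z y - p z) (v y),
    ⟨fun x => isChoiceRule_tieRule _ (hw x), fun y => isChoiceRule_tieRule _ (hv y),
      fun z => ?_⟩, fun x => isRational_tieRule _ (hw x), fun y => isRational_tieRule _ (hv y)⟩
  simpa only [← hwq, ← hvr] using hz z

theorem IsAllocation.isEquilibrium (hE : E.IsRegular)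
    {σ : X → (Option Z → ℝ) → Option Z → ℝ} {τ : Y → (Option Z → ℝ) → Option Z → ℝ}
    (h : E.IsAllocation σ τ) {p : Z → ℝ}
    (hσ : ∀ x, IsRational (E.P x) (fun z => E.α x z + p z) (σ x))
    (hτ : ∀ y, IsRational (E.Q y) (fun z => E.γ z y - p z) (τ y)) :
    E.IsEquilibrium p (fun x z => E.n x * share (E.P x) (σ x) z)
      (fun z y => E.m y * share (E.Q y) (τ y) z) := by
  have := hE.prob_P
  have := hE.prob_Q
  refine ⟨⟨fun x z => mul_nonneg (hE.n_pos x).le ((h.producers x).share_nonneg z),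
    fun z y => mul_nonneg (hE.m_pos y).le ((h.consumers y).share_nonneg z),
    fun x => ?_, fun y => ?_, h.clearing⟩,
    fun x => ⟨σ x, h.producers x, hσ x, fun z => rfl⟩,
    fun y => ⟨τ y, h.consumers y, hτ y, fun z => rfl⟩⟩
  · rw [← Finset.mul_sum]
    exact mul_le_of_le_one_right (hE.n_pos x).le (h.producers x).sum_share_le_one
  · rw [← Finset.mul_sum]
    exact mul_le_of_le_one_right (hE.m_pos y).le (h.consumers y).sum_share_le_one

/-- Without ties, feasible quantities without duality gap at `p` are those generated by any
rational choice rules at `p`. -/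
theorem IsFeasible.eq_share_of_quantityObjective_eq (hE : E.IsRegular)
    (hP : ∀ x, NoTies (E.P x)) (hQ : ∀ y, NoTies (E.Q y)) {p : Z → ℝ} {μ : X → Z → ℝ}
    {ν : Z → Y → ℝ} (h : E.IsFeasible μ ν) (hobj : E.quantityObjective μ ν = E.totalSurplus p)
    {σ : X → (Option Z → ℝ) → Option Z → ℝ} {τ : Y → (Option Z → ℝ) → Option Z → ℝ}
    (hall : E.IsAllocation σ τ)
    (hσ : ∀ x, IsRational (E.P x) (fun z => E.α x z + p z) (σ x))
    (hτ : ∀ y, IsRational (E.Q y) (fun z => E.γ z y - p z) (τ y)) :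
    μ = (fun x z => E.n x * share (E.P x) (σ x) z) ∧
      ν = (fun z y => E.m y * share (E.Q y) (τ y) z) := by
  have := hE.prob_P
  have := hE.prob_Q
  obtain ⟨c, e, -, -, hU, hV, heq⟩ := h.exists_quantityObjective_eq hE
  have h1 : ∀ x ∈ Finset.univ, 0 ≤ E.n x * E.supplyGap μ p x (c x) := fun x _ =>
    mul_nonneg (hE.n_pos x).le (sub_nonneg.2 (hU x _))
  have h2 : ∀ y ∈ Finset.univ, 0 ≤ E.m y * E.demandGap ν p y (e y) := fun y _ =>
    mul_nonneg (hE.m_pos y).le (sub_nonneg.2 (hV y _))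
  rw [heq p, EReal.coe_eq_coe_iff] at hobj
  have h3 := Finset.sum_nonneg h1
  have h4 := Finset.sum_nonneg h2
  have h5 := (Finset.sum_eq_zero_iff_of_nonneg h1).1 (by linarith)
  have h6 := (Finset.sum_eq_zero_iff_of_nonneg h2).1 (by linarith)
  constructor
  · ext x z
    have hx : E.supplyGap μ p x (c x) = 0 :=
      (mul_eq_zero.1 (h5 x (Finset.mem_univ x))).resolve_left (hE.n_pos x).ne'
    have hq := (hP x).eq_share_of_subgradient (hE.integrable_P x)
      (U := fun z => E.α x z + p z) (q := fun z => μ x z / E.n x)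
      (fun V => (hU x V).trans (sub_eq_zero.1 hx).le) (hall.producers x) (hσ x)
    rw [← hq, mul_div_cancel₀ _ (hE.n_pos x).ne']
  · ext z y
    have hy : E.demandGap ν p y (e y) = 0 :=
      (mul_eq_zero.1 (h6 y (Finset.mem_univ y))).resolve_left (hE.m_pos y).ne'
    have hq := (hQ y).eq_share_of_subgradient (hE.integrable_Q y)
      (U := fun z => E.γ z y - p z) (q := fun z => ν z y / E.m y)
      (fun V => (hV y V).trans (sub_eq_zero.1 hy).le) (hall.consumers y) (hτ y)
    rw [← hq, mul_div_cancel₀ _ (hE.m_pos y).ne']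

end Economy

end Hedonic

theorem theorem3 {X Y Z : Type*} [Fintype X] [Fintype Y] [Fintype Z] [Nonempty X] [Nonempty Y]
    (E : Hedonic.Economy X Y Z)
    (hn : ∀ x, 0 < E.n x) (hm : ∀ y, 0 < E.m y)
    (hP : ∀ x, IsProbabilityMeasure (E.P x)) (hQ : ∀ y, IsProbabilityMeasure (E.Q y))
    -- the shocks have finite expectations
    (hPint : ∀ x o, Integrable (fun ε : Option Z → ℝ => ε o) (E.P x))
    (hQint : ∀ y o, Integrable (fun ε : Option Z → ℝ => ε o) (E.Q y))
    -- full support: every nonempty open set of shocks has positive probability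
    (hPsupp : ∀ x, (E.P x).IsOpenPosMeasure) (hQsupp : ∀ y, (E.Q y).IsOpenPosMeasure) :
    ∃ W : ℝ,
      -- `W` is the optimal social welfare
      IsGreatest {w | ∃ σ τ, E.IsAllocation σ τ ∧ w = E.welfare σ τ} W ∧
      -- (i)
      IsLeast (Set.range E.totalSurplus) W ∧
      -- (ii)
      IsGreatest {w | ∃ μ ν, E.IsFeasible μ ν ∧ w = E.quantityObjective μ ν} (W : EReal) ∧
      -- (iii)
      (∃ p μ ν, E.IsEquilibrium p μ ν) ∧
      (∀ p μ ν, E.IsEquilibrium p μ ν →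
        E.totalSurplus p = W ∧ E.quantityObjective μ ν = (W : EReal)) ∧
      (∃! p, E.totalSurplus p = W) ∧
      ((∀ x, Hedonic.NoTies (E.P x)) → (∀ y, Hedonic.NoTies (E.Q y)) →
        (∃! e : (Z → ℝ) × (X → Z → ℝ) × (Z → Y → ℝ), E.IsEquilibrium e.1 e.2.1 e.2.2) ∧
        (∃! f : (X → Z → ℝ) × (Z → Y → ℝ),
          E.IsFeasible f.1 f.2 ∧ E.quantityObjective f.1 f.2 = (W : EReal))) := by
  have hE : E.IsRegular := ⟨hn, hm, hP, hQ, hPint, hQint⟩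
  obtain ⟨p, hp⟩ := Hedonic.Economy.exists_forall_totalSurplus_le hE
  obtain ⟨σ, τ, hall, hσ, hτ⟩ := Hedonic.Economy.exists_rational_allocation hE hp
  have heq := hall.isEquilibrium hE hσ hτ
  have hequil : ∀ p' μ ν, E.IsEquilibrium p' μ ν → E.totalSurplus p' = E.totalSurplus p ∧
      E.quantityObjective μ ν = (E.totalSurplus p : EReal) := by
    intro p' μ ν h
    have h1 := h.quantityObjective_eq hE
    have h2 := h.feasible.quantityObjective_le hE p
    rw [h1, EReal.coe_le_coe_iff] at h2
    have h3 := le_antisymm h2 (hp p')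
    exact ⟨h3, by rw [h1, h3]⟩
  have huniq : ∀ p', E.totalSurplus p' = E.totalSurplus p → p' = p := by
    intro p' h
    by_contra hne
    have h1 := Hedonic.Economy.totalSurplus_midpoint_lt hE hPsupp hne
    have h2 := hp fun z => (p' z + p z) / 2
    linarith
  refine ⟨E.totalSurplus p, ⟨⟨σ, τ, hall, (hall.welfare_eq_totalSurplus hE hσ hτ).symm⟩, ?_⟩,
    ⟨⟨p, rfl⟩, ?_⟩, ⟨⟨_, _, heq.feasible, (heq.quantityObjective_eq hE).symm⟩, ?_⟩,
    ⟨p, _, _, heq⟩, hequil, ⟨p, rfl, huniq⟩, fun hPt hQt => ⟨⟨(p, _, _), heq, ?_⟩,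
    ⟨(_, _), ⟨heq.feasible, heq.quantityObjective_eq hE⟩, ?_⟩⟩⟩
  · rintro _ ⟨σ', τ', h, rfl⟩
    exact h.welfare_le hE p
  · rintro _ ⟨p', rfl⟩
    exact hp p'
  · rintro _ ⟨μ, ν, h, rfl⟩
    exact h.quantityObjective_le hE p
  · rintro ⟨p', μ, ν⟩ h
    obtain ⟨h1, h2⟩ := hequil p' μ ν h
    obtain ⟨h3, h4⟩ := h.feasible.eq_share_of_quantityObjective_eq hE hPt hQt h2 hall hσ hτ
    exact Prod.ext (huniq p' h1) (Prod.ext h3 h4)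
  · rintro ⟨μ, ν⟩ ⟨h1, h2⟩
    obtain ⟨h3, h4⟩ := h1.eq_share_of_quantityObjective_eq hE hPt hQt h2 hall hσ hτ
    exact Prod.ext h3 h4
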